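/- **Theorem.** Let $W$ be an $M$-user discrete memoryless multiple-access channel, with finite input alphabets $\mathcal X_1,\dots,\mathcal X_M$, a finite output alphabet $\mathcal Y$ and transition probabilities $W(y\mid x_1,\dots,x_M)$. Let $X_1,\dots,X_M$ be independent inputs with distributions $P_{X_1},\dots,P_{X_M}$ and let $Y$ be the corresponding output. Write $[M]=\{1,\dots,M\}$, $X_{\mathcal S}=(X_i)_{i\in\mathcal S}$, $R(\mathcal S)=\sum_{i\in\mathcal S}R_i$, $\mathcal S^c=[M]\setminus\mathcal S$, and let $$\mathcal R=\{R\in\mathbb R_{\ge 0}^M:\ R(\mathcal S)\le I(X_{\mathcal S};Y\mid X_{\mathcal S^c})\ \text{ for all } \mathcal S\subseteq[M]\}.$$ Assume that $\mathcal R$ is non-degenerated, that is, 1. $I(X_{\mathcal S};Y)>0$ for every non-empty $\mathcal S\subseteq[M]$, and 2. $I(X_{\mathcal S};Y\mid X_{\mathcal A})<I(X_{\mathcal S};Y\mid X_{\mathcal B})$ whenever $\emptyset\subsetneq\mathcal S\subsetneq[M]$, $\mathcal A\subsetneq\mathcal B\subsetneq[M]$ and $\mathcal S\cap\mathcal B=\emptyset$.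 A face of $\mathcal R$ is a set $\mathcal R\cap\{R: \sum_i R_ia_i=a_0\}$, where $a\in\mathbb R^M$, $a_0\in\mathbb R$ and the inequality $\sum_i R_ia_i\le a_0$ holds for all $R\in\mathcal R$; its dimension is the dimension of its affine hull (the empty face has dimension $-1$). Then for every integer $D$ with $0\le D\le M$ the number $N(M,D)$ of $D$-dimensional faces of $\mathcal R$ is finite and $$N(M,D)=\sum_{i=D}^{M}\binom{M}{i}\left[(i+1-D)^i-\sum_{j=1}^{i-D}\binom{i-D}{j-1}(-1)^{i-D-j}j^i\right],$$ where $0^0=1$ and empty sums are $0$. -/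

import Mathlib

namespace MAC

open Finset

section Information

/-- The law of the random variable `U` on the finite probability space with mass function `p`. -/
noncomputable def law {Ω α : Type*} [Fintype Ω] (p : Ω → ℝ) (U : Ω → α) (u : α) : ℝ :=
  open Classical in ∑ ω with U ω = u, p ω

/-- Conditional mutual information `I(U; V | Z)` in bits,
`∑ p(u,v,z) log₂ (p(u,v,z) p(z) / (p(u,z) p(v,z)))`, of random variables on a finite
probability space with mass function `p`. Terms with `p(u,v,z) = 0` vanish, and the
denominator is nonzero in all other terms. -/
noncomputable def condMutualInfo {Ω α β γ : Type*} [Fintype Ω] [Fintype α] [Fintype β] [Fintype γ]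
    (p : Ω → ℝ) (U : Ω → α) (V : Ω → β) (Z : Ω → γ) : ℝ :=
  ∑ u, ∑ v, ∑ z, law p (fun ω => (U ω, V ω, Z ω)) (u, v, z) *
    Real.logb 2 (law p (fun ω => (U ω, V ω, Z ω)) (u, v, z) * law p Z z /
      (law p (fun ω => (U ω, Z ω)) (u, z) * law p (fun ω => (V ω, Z ω)) (v, z)))

end Information

section Channel

variable {M : ℕ} {𝒳 : Fin M → Type*} [∀ i, Fintype (𝒳 i)] {𝒴 : Type*} [Fintype 𝒴]

/-- Joint mass function of the inputs and the output, for the channel `W` (`W x y` is the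
probability of output `y` given inputs `x`) and independent inputs with distributions `P i`. -/
def jointPMF (W : (∀ i, 𝒳 i) → 𝒴 → ℝ) (P : ∀ i, 𝒳 i → ℝ) (ω : (∀ i, 𝒳 i) × 𝒴) : ℝ :=
  (∏ i, P i (ω.1 i)) * W ω.1 ω.2

/-- `I(X_S; Y | X_A)`. For `A = ∅` the variable `X_A` is constant and this is `I(X_S; Y)`. -/
noncomputable def info (W : (∀ i, 𝒳 i) → 𝒴 → ℝ) (P : ∀ i, 𝒳 i → ℝ) (S A : Finset (Fin M)) : ℝ :=
  condMutualInfo (jointPMF W P) (fun ω => S.restrict ω.1) (fun ω => ω.2) (fun ω => A.restrict ω.1)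

/-- The region of all `R ∈ ℝ₊^M` with `R(S) ≤ I(X_S; Y | X_{Sᶜ})` for all `S ⊆ [M]`. -/
def rateRegion (W : (∀ i, 𝒳 i) → 𝒴 → ℝ) (P : ∀ i, 𝒳 i → ℝ) : Set (Fin M → ℝ) :=
  {R | (∀ i, 0 ≤ R i) ∧ ∀ S : Finset (Fin M), ∑ i ∈ S, R i ≤ info W P S Sᶜ}

/-- Non-degeneracy of the region given by `W` and `P`. -/
structure NonDegenerated (W : (∀ i, 𝒳 i) → 𝒴 → ℝ) (P : ∀ i, 𝒳 i → ℝ) : Prop where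
  info_pos : ∀ S : Finset (Fin M), S.Nonempty → 0 < info W P S ∅
  info_lt : ∀ S A B : Finset (Fin M), S.Nonempty → S ⊂ univ → A ⊂ B → B ⊂ univ → Disjoint S B →
    info W P S A < info W P S B

end Channel

section Polytope

variable {M : ℕ}

/-- `F` is a face of `C`: the set of points of `C` at which some linear inequality
`R a ≤ a₀`, valid on `C`, holds with equality. -/
def IsFace (C F : Set (Fin M → ℝ)) : Prop :=
  ∃ (a : Fin M → ℝ) (a₀ : ℝ), (∀ R ∈ C, R ⬝ᵥ a ≤ a₀) ∧ F = C ∩ {R | R ⬝ᵥ a = a₀}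

/-- The dimension of the affine hull of `F`, which is `-1` for the empty set. -/
noncomputable def affDim (F : Set (Fin M → ℝ)) : ℤ :=
  open Classical in
  if F = ∅ then -1 else (Module.finrank ℝ (affineSpan ℝ F).direction : ℤ)

/-- The set of all `D`-dimensional faces of `C`. -/
def facesOfDim (C : Set (Fin M → ℝ)) (D : ℕ) : Set (Set (Fin M → ℝ)) :=
  {F | IsFace C F ∧ affDim F = D}

end Polytope

end MAC

/-! Put f(S) = I(X_S; Y | X_{Sᶜ}). All the informations I(X_S; Y | X_A) are increments of one set
function φ, so f(S) = φ([M]) − φ(Sᶜ). Non-degeneracy makes φ strictly increasing and strictly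
supermodular, hence f a strict polymatroid (`NonDegenerated.isStrictPolymatroid`). Only this
property of f is used afterwards.

A non-empty face of a polyhedron is determined by the inequalities tight on all of it. For a strict
polymatroid these are encoded by a support T, off which the coordinates vanish, and a chain 𝒞 of
non-empty subsets of T (`IsStrictPoint.exists_isFlag`): two crossing tight sets would contradict
strict submodularity. Every pair (T, 𝒞) occurs, because suitable averages of greedy points have no
further tight inequality (`IsFlag.exists_isStrictPoint`). The face has dimension #T − #𝒞
(`IsFlag.finrank_tightSubmodule`).

It remains to count the chains of k = #T − D sets. They correspond to the maps from T to k + 1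
values that attain every value except possibly the top one, and inclusion-exclusion over the missed
values gives the formula. -/

namespace MAC

open Finset

/-! ### Entropy, and the strict polymatroid of a non-degenerated channel. -/

section Information

theorem sum_law_mul {Ω α : Type*} [Fintype Ω] [Fintype α] (p : Ω → ℝ) (U : Ω → α) (F : α → ℝ) :
    ∑ u, law p U u * F u = ∑ ω, p ω * F (U ω) := by
  classical
  have h : ∀ u, law p U u * F u = ∑ ω with U ω = u, p ω * F (U ω) := by
    intro u
    rw [law, Finset.sum_mul]
    refine Finset.sum_congr (by congr) fun ω hω => ?_
    rw [(Finset.mem_filter.1 hω).2]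
  simp_rw [h]
  exact Finset.sum_fiberwise _ _ _

theorem law_congr {Ω α β : Type*} [Fintype Ω] (p : Ω → ℝ) {U : Ω → α} {V : Ω → β} {ω : Ω}
    (h : ∀ ω', U ω' = U ω ↔ V ω' = V ω) : law p U (U ω) = law p V (V ω) := by
  classical
  unfold law
  refine Finset.sum_congr ?_ fun _ _ => rfl
  ext ω'
  simp [h]

theorem law_pos {Ω α : Type*} [Fintype Ω] {p : Ω → ℝ} (hp : ∀ ω, 0 ≤ p ω) (U : Ω → α) {ω : Ω}
    (hω : p ω ≠ 0) : 0 < law p U (U ω) := by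
  classical
  unfold law
  exact Finset.sum_pos' (fun i _ => hp i)
    ⟨ω, by simp, lt_of_le_of_ne (hp ω) hω.symm⟩

/-- Shannon entropy in bits. -/
noncomputable def entropy {Ω α : Type*} [Fintype Ω] (p : Ω → ℝ) (U : Ω → α) : ℝ :=
  -∑ ω, p ω * Real.logb 2 (law p U (U ω))

theorem entropy_congr {Ω α β : Type*} [Fintype Ω] (p : Ω → ℝ) {U : Ω → α} {V : Ω → β}
    (h : ∀ ω ω', U ω' = U ω ↔ V ω' = V ω) : entropy p U = entropy p V := by
  unfold entropy
  simp_rw [fun ω => law_congr p (h ω)]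

theorem condMutualInfo_eq_entropy {Ω α β γ : Type*} [Fintype Ω] [Fintype α] [Fintype β]
    [Fintype γ] {p : Ω → ℝ} (hp : ∀ ω, 0 ≤ p ω) (U : Ω → α) (V : Ω → β) (Z : Ω → γ) :
    condMutualInfo p U V Z = entropy p (fun ω => (U ω, Z ω)) + entropy p (fun ω => (V ω, Z ω)) -
      entropy p (fun ω => (U ω, V ω, Z ω)) - entropy p Z := by
  have h := sum_law_mul p (fun ω => (U ω, V ω, Z ω)) (fun t =>
    Real.logb 2 (law p (fun ω => (U ω, V ω, Z ω)) t * law p Z t.2.2 /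
      (law p (fun ω => (U ω, Z ω)) (t.1, t.2.2) * law p (fun ω => (V ω, Z ω)) t.2)))
  simp only [Fintype.sum_prod_type] at h
  rw [condMutualInfo, h]
  simp only [entropy, sub_eq_add_neg, neg_neg]
  simp only [← Finset.sum_neg_distrib, ← Finset.sum_add_distrib]
  refine Finset.sum_congr rfl fun ω _ => ?_
  by_cases hω : p ω = 0
  · simp [hω]
  have h1 := (law_pos hp (fun ω => (U ω, V ω, Z ω)) hω).ne'
  have h2 := (law_pos hp Z hω).ne'
  have h3 := (law_pos hp (fun ω => (U ω, Z ω)) hω).ne'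
  have h4 := (law_pos hp (fun ω => (V ω, Z ω)) hω).ne'
  rw [Real.logb_div (mul_ne_zero h1 h2) (mul_ne_zero h3 h4), Real.logb_mul h1 h2,
    Real.logb_mul h3 h4]
  ring

end Information

theorem restrict_eq_restrict_iff {M : ℕ} {𝒳 : Fin M → Type*} {S : Finset (Fin M)} {x y : ∀ i, 𝒳 i} :
    S.restrict x = S.restrict y ↔ ∀ i ∈ S, x i = y i := by
  simp [funext_iff, Finset.restrict]

section Channel

variable {M : ℕ} {𝒳 : Fin M → Type*} [∀ i, Fintype (𝒳 i)] {𝒴 : Type*} [Fintype 𝒴]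

theorem jointPMF_nonneg {W : (∀ i, 𝒳 i) → 𝒴 → ℝ} (hW : ∀ x, W x ∈ stdSimplex ℝ 𝒴)
    {P : ∀ i, 𝒳 i → ℝ} (hP : ∀ i, P i ∈ stdSimplex ℝ (𝒳 i)) (ω : (∀ i, 𝒳 i) × 𝒴) :
    0 ≤ jointPMF W P ω :=
  mul_nonneg (Finset.prod_nonneg fun i _ => (hP i).1 _) ((hW _).1 _)

/-- The conditional mutual information of the inputs `S` and the output given the inputs `A` is
the increment from `A` to `A ∪ S` of a set function. -/
theorem exists_info_eq_sub {W : (∀ i, 𝒳 i) → 𝒴 → ℝ} (hW : ∀ x, W x ∈ stdSimplex ℝ 𝒴)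
    {P : ∀ i, 𝒳 i → ℝ} (hP : ∀ i, P i ∈ stdSimplex ℝ (𝒳 i)) :
    ∃ φ : Finset (Fin M) → ℝ, ∀ S A, info W P S A = φ (A ∪ S) - φ A := by
  -- φ(A) = H(X_A) − H(Y, X_A) = −H(Y | X_A).
  refine ⟨fun A => entropy (jointPMF W P) (fun ω => A.restrict ω.1) -
    entropy (jointPMF W P) (fun ω => (ω.2, A.restrict ω.1)), fun S A => ?_⟩
  have h1 : entropy (jointPMF W P) (fun ω => (S.restrict ω.1, A.restrict ω.1)) =
      entropy (jointPMF W P) (fun ω => (A ∪ S).restrict ω.1) := by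
    refine entropy_congr _ fun ω ω' => ?_
    simp only [Prod.mk.injEq, restrict_eq_restrict_iff, mem_union]
    grind
  have h2 : entropy (jointPMF W P) (fun ω => (S.restrict ω.1, ω.2, A.restrict ω.1)) =
      entropy (jointPMF W P) (fun ω => (ω.2, (A ∪ S).restrict ω.1)) := by
    refine entropy_congr _ fun ω ω' => ?_
    simp only [Prod.mk.injEq, restrict_eq_restrict_iff, mem_union]
    grind
  rw [info, condMutualInfo_eq_entropy (jointPMF_nonneg hW hP), h1, h2]
  ring

end Channel

/-- A normalized, strictly increasing, strictly submodular set function. -/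
structure IsStrictPolymatroid {α : Type*} [DecidableEq α] (f : Finset α → ℝ) : Prop where
  map_empty : f ∅ = 0
  strictMono : StrictMono f
  submodular : ∀ S T, ¬ S ⊆ T → ¬ T ⊆ S → f (S ∪ T) + f (S ∩ T) < f S + f T

theorem NonDegenerated.isStrictPolymatroid {M : ℕ} {𝒳 : Fin M → Type*} [∀ i, Fintype (𝒳 i)]
    {𝒴 : Type*} [Fintype 𝒴] {W : (∀ i, 𝒳 i) → 𝒴 → ℝ} (hW : ∀ x, W x ∈ stdSimplex ℝ 𝒴)
    {P : ∀ i, 𝒳 i → ℝ} (hP : ∀ i, P i ∈ stdSimplex ℝ (𝒳 i)) (hR : NonDegenerated W P) :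
    IsStrictPolymatroid fun S => info W P S Sᶜ := by
  obtain ⟨φ, hφ⟩ := exists_info_eq_sub hW hP
  have hpos : ∀ S, S.Nonempty → φ ∅ < φ S := by
    intro S hS
    have := hR.info_pos S hS
    rw [hφ, empty_union] at this
    linarith
  have hsup : ∀ S A B : Finset (Fin M), S.Nonempty → A ⊂ B → Disjoint S B →
      φ (A ∪ S) - φ A < φ (B ∪ S) - φ B := by
    intro S A B hS hAB hSB
    rw [← hφ, ← hφ]
    obtain ⟨s, hs⟩ := hS
    obtain ⟨b, hb, -⟩ := Finset.exists_of_ssubset hAB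
    have hsB : s ∉ B := Finset.disjoint_left.1 hSB hs
    have hbS : b ∉ S := Finset.disjoint_right.1 hSB hb
    -- Properness of `S` and of `B` is automatic: `b` lies outside `S` and `s` outside `B`.
    refine hR.info_lt S A B ⟨s, hs⟩ ?_ hAB ?_ hSB
    · exact Finset.ssubset_univ_iff.2 fun h => hbS (h ▸ mem_univ b)
    · exact Finset.ssubset_univ_iff.2 fun h => hsB (h ▸ mem_univ s)
  have hmono : StrictMono φ := by
    intro A B hAB
    have hAB' : A ⊂ B := hAB
    rcases A.eq_empty_or_nonempty with rfl | hA
    · exact hpos B (Finset.empty_ssubset.1 hAB')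
    · have hD : (B \ A).Nonempty := Finset.sdiff_nonempty.2 hAB'.2
      -- The increment from `A` to `B` exceeds the increment of `B \ A` over `∅`, which is positive.
      have h := hsup (B \ A) ∅ A hD (Finset.empty_ssubset.2 hA) Finset.sdiff_disjoint
      rw [Finset.empty_union, Finset.union_sdiff_of_subset hAB'.1] at h
      have := hpos _ hD
      linarith
  have hf : ∀ S : Finset (Fin M), info W P S Sᶜ = φ univ - φ Sᶜ := by
    intro S
    rw [hφ, Finset.union_comm, Finset.union_compl]
  simp_rw [hf]
  refine ⟨by simp, ?_, ?_⟩
  · intro S T hST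
    have := hmono (Finset.compl_ssubset_compl.2 hST)
    simp only
    linarith
  · intro S T hST hTS
    -- Complementation turns supermodularity of φ into submodularity: adding `S \ T` leads from (S ∪
    -- T)ᶜ to Tᶜ and from Sᶜ to (S ∩ T)ᶜ.
    have h := hsup (S \ T) (S ∪ T)ᶜ Sᶜ (Finset.sdiff_nonempty.2 hST) ?_ ?_
    · have e1 : (S ∪ T)ᶜ ∪ S \ T = Tᶜ := by ext i; simp; tauto
      have e2 : Sᶜ ∪ S \ T = (S ∩ T)ᶜ := by ext i; simp; tauto
      rw [e1, e2] at h
      linarith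
    · refine Finset.compl_ssubset_compl.2 ⟨Finset.subset_union_left, fun h => hTS ?_⟩
      exact Finset.subset_union_right.trans h
    · rw [Finset.disjoint_left]
      intro i hi
      simp at hi ⊢
      exact hi.1

end MAC

namespace MAC

open Finset Filter Topology

/-! ### Faces of a polyhedron and their tight inequalities. -/

section Polyhedron

variable {M : ℕ} {ι : Type*}

/-- The polyhedron given by the inequalities `x ⬝ᵥ c k ≤ b k`. -/
def polyhedron (c : ι → Fin M → ℝ) (b : ι → ℝ) : Set (Fin M → ℝ) := {x | ∀ k, x ⬝ᵥ c k ≤ b k}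

/-- The points of a polyhedron at which all inequalities in `J` are tight. -/
def tightFace (c : ι → Fin M → ℝ) (b : ι → ℝ) (J : Set ι) : Set (Fin M → ℝ) :=
  {x | x ∈ polyhedron c b ∧ ∀ k ∈ J, x ⬝ᵥ c k = b k}

/-- A point at which exactly the inequalities in `J` are tight. -/
def IsStrictPoint (c : ι → Fin M → ℝ) (b : ι → ℝ) (J : Set ι) (x : Fin M → ℝ) : Prop :=
  x ∈ tightFace c b J ∧ ∀ k ∉ J, x ⬝ᵥ c k < b k

/-- The vectors orthogonal to all `c k` with `k ∈ J`. -/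
def tightSubmodule (c : ι → Fin M → ℝ) (J : Set ι) : Submodule ℝ (Fin M → ℝ) where
  carrier := {v | ∀ k ∈ J, v ⬝ᵥ c k = 0}
  add_mem' := by
    intro v w hv hw k hk
    rw [add_dotProduct, hv k hk, hw k hk, add_zero]
  zero_mem' := by simp
  smul_mem' := by
    intro t v hv k hk
    rw [smul_dotProduct, hv k hk, smul_zero]

variable {c : ι → Fin M → ℝ} {b : ι → ℝ} {J : Set ι}

theorem convex_tightFace : Convex ℝ (tightFace c b J) := by
  intro x hx y hy s t hs ht hst
  refine ⟨fun k => ?_, fun k hk => ?_⟩ <;>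
    rw [add_dotProduct, smul_dotProduct, smul_dotProduct, smul_eq_mul, smul_eq_mul]
  · have h1 := mul_le_mul_of_nonneg_left (hx.1 k) hs
    have h2 := mul_le_mul_of_nonneg_left (hy.1 k) ht
    have h3 : s * b k + t * b k = b k := by rw [← add_mul, hst, one_mul]
    linarith
  · rw [hx.2 k hk, hy.2 k hk, ← add_mul, hst, one_mul]

/-- Slackness survives midpoints: a point slack at one inequality can be averaged with another point
of `F` and the midpoint stays slack there. -/
theorem exists_forall_dotProduct_lt [Finite ι] {F : Set (Fin M → ℝ)} (hF : Convex ℝ F)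
    (hFC : F ⊆ polyhedron c b) (hne : F.Nonempty) (h : ∀ k ∉ J, ∃ x ∈ F, x ⬝ᵥ c k < b k) :
    ∃ x ∈ F, ∀ k ∉ J, x ⬝ᵥ c k < b k := by
  classical
  have := Fintype.ofFinite ι
  have key : ∀ s : Finset ι, ∃ x ∈ F, ∀ k ∈ s, k ∉ J → x ⬝ᵥ c k < b k := by
    intro s
    induction s using Finset.induction_on with
    | empty => exact ⟨hne.some, hne.some_mem, by simp⟩
    | insert k s hk ih =>
      obtain ⟨x, hx, hxs⟩ := ih
      by_cases hkJ : k ∈ J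
      · refine ⟨x, hx, fun l hl hlJ => hxs l ?_ hlJ⟩
        exact (Finset.mem_insert.1 hl).resolve_left fun e => hlJ (e ▸ hkJ)
      obtain ⟨y, hy, hyk⟩ := h k hkJ
      refine ⟨(1 / 2 : ℝ) • x + (1 / 2 : ℝ) • y,
        hF hx hy (by norm_num) (by norm_num) (by norm_num), fun l hl hlJ => ?_⟩
      rw [add_dotProduct, smul_dotProduct, smul_dotProduct, smul_eq_mul, smul_eq_mul]
      have h1 := hFC hx l
      have h2 := hFC hy l
      rcases Finset.mem_insert.1 hl with rfl | hl
      · linarith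
      · have := hxs l hl hlJ
        linarith
  obtain ⟨x, hx, h⟩ := key Finset.univ
  exact ⟨x, hx, fun k hk => h k (Finset.mem_univ k) hk⟩

theorem IsStrictPoint.exists_add_smul_mem [Finite ι] {x : Fin M → ℝ} (hx : IsStrictPoint c b J x)
    {v : Fin M → ℝ} (hv : v ∈ tightSubmodule c J) :
    ∃ ε : ℝ, 0 < ε ∧ x + ε • v ∈ tightFace c b J := by
  have key : ∀ᶠ ε : ℝ in 𝓝[>] 0, ∀ k, (x + ε • v) ⬝ᵥ c k ≤ b k := by
    rw [Filter.eventually_all]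
    intro k
    by_cases hk : k ∈ J
    · refine Filter.Eventually.of_forall fun ε => ?_
      rw [add_dotProduct, smul_dotProduct, hv k hk, smul_zero, add_zero]
      exact hx.1.1 k
    · have hc : Continuous fun ε : ℝ => x ⬝ᵥ c k + ε * (v ⬝ᵥ c k) := by fun_prop
      have h0 : ∀ᶠ ε : ℝ in 𝓝 0, x ⬝ᵥ c k + ε * (v ⬝ᵥ c k) < b k := by
        refine hc.continuousAt.eventually_lt continuousAt_const ?_
        simpa using hx.2 k hk
      filter_upwards [nhdsWithin_le_nhds h0] with ε hε
      rw [add_dotProduct, smul_dotProduct, smul_eq_mul]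
      exact hε.le
  obtain ⟨ε, hε, hpos⟩ := (key.and self_mem_nhdsWithin).exists
  refine ⟨ε, hpos, hε, fun k hk => ?_⟩
  rw [add_dotProduct, smul_dotProduct, hv k hk, smul_zero, add_zero]
  exact hx.1.2 k hk

theorem isFace_tightFace [Finite ι] : IsFace (polyhedron c b) (tightFace c b J) := by
  classical
  have := Fintype.ofFinite ι
  -- The sum of the inequalities in `J` is an equality only when each of them is.
  refine ⟨∑ k with k ∈ J, c k, ∑ k with k ∈ J, b k, fun x hx => ?_, ?_⟩
  · rw [dotProduct_sum]
    exact Finset.sum_le_sum fun k _ => hx k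
  · ext x
    simp only [tightFace, Set.mem_ofPred_eq, Set.mem_inter_iff]
    refine and_congr_right fun hx => ?_
    rw [dotProduct_sum, Finset.sum_eq_sum_iff_of_le fun k _ => hx k]
    simp

/-- `J` consists of the inequalities tight on the whole face, and a strict point plays the role of a
relative interior point; no duality is needed. -/
theorem IsFace.exists_eq_tightFace [Finite ι] {F : Set (Fin M → ℝ)}
    (hF : IsFace (polyhedron c b) F) (hne : F.Nonempty) :
    ∃ (J : Set ι) (x : Fin M → ℝ), IsStrictPoint c b J x ∧ F = tightFace c b J := by
  obtain ⟨a, a₀, hle, rfl⟩ := hF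
  set F := polyhedron c b ∩ {R | R ⬝ᵥ a = a₀} with hFdef
  have hconv : Convex ℝ F := by
    intro x hx y hy s t hs ht hst
    refine ⟨((convex_tightFace (c := c) (b := b) (J := ∅)) ⟨hx.1, by simp⟩ ⟨hy.1, by simp⟩
      hs ht hst).1, ?_⟩
    have h1 : x ⬝ᵥ a = a₀ := hx.2
    have h2 : y ⬝ᵥ a = a₀ := hy.2
    simp only [Set.mem_ofPred_eq, add_dotProduct, smul_dotProduct, h1, h2, smul_eq_mul]
    rw [← add_mul, hst, one_mul]
  set J : Set ι := {k | ∀ x ∈ F, x ⬝ᵥ c k = b k} with hJ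
  obtain ⟨x, hx, hxs⟩ := exists_forall_dotProduct_lt (J := J) hconv Set.inter_subset_left hne (by
    intro k hk
    simp only [hJ, Set.mem_ofPred_eq, not_forall] at hk
    obtain ⟨x, hx, hne⟩ := hk
    exact ⟨x, hx, lt_of_le_of_ne (hx.1 k) hne⟩)
  have hxJ : IsStrictPoint c b J x := ⟨⟨hx.1, fun k hk => hk x hx⟩, hxs⟩
  refine ⟨J, x, hxJ, Set.Subset.antisymm (fun y hy => ⟨hy.1, fun k hk => hk y hy⟩) ?_⟩
  intro y hy
  -- Moving from `x` slightly away from `y` stays in the polyhedron. If `y` were below the level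
  -- `a₀` of `x`, the moved point would be above it.
  obtain ⟨ε, hε, hmem⟩ := hxJ.exists_add_smul_mem (v := x - y) (by
    intro k hk
    rw [sub_dotProduct, hxJ.1.2 k hk, hy.2 k hk, sub_self])
  refine ⟨hy.1, le_antisymm (hle y hy.1) ?_⟩
  have h1 := hle _ hmem.1
  have h2 : x ⬝ᵥ a = a₀ := hx.2
  rw [add_dotProduct, smul_dotProduct, sub_dotProduct, h2, smul_eq_mul] at h1
  have h3 : ε * (a₀ - y ⬝ᵥ a) ≤ 0 := by linarith
  have := nonpos_of_mul_nonpos_right h3 hε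
  linarith

theorem IsStrictPoint.eq_setOf {x : Fin M → ℝ} (hx : IsStrictPoint c b J x) :
    J = {k | ∀ y ∈ tightFace c b J, y ⬝ᵥ c k = b k} := by
  ext k
  refine ⟨fun hk y hy => hy.2 k hk, fun h => ?_⟩
  by_contra hk
  exact (hx.2 k hk).ne (h x hx.1)

theorem IsStrictPoint.affDim_tightFace [Finite ι] {x : Fin M → ℝ} (hx : IsStrictPoint c b J x) :
    affDim (tightFace c b J) = Module.finrank ℝ (tightSubmodule c J) := by
  have hne : tightFace c b J ≠ ∅ := Set.Nonempty.ne_empty ⟨x, hx.1⟩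
  rw [affDim, if_neg hne]
  suffices h : (affineSpan ℝ (tightFace c b J)).direction = tightSubmodule c J by rw [h]
  rw [direction_affineSpan]
  apply le_antisymm
  · rw [vectorSpan_def, Submodule.span_le]
    rintro _ ⟨y, hy, z, hz, rfl⟩ k hk
    simp only [vsub_eq_sub, sub_dotProduct]
    rw [hy.2 k hk, hz.2 k hk, sub_self]
  · intro v hv
    obtain ⟨ε, hε, hmem⟩ := hx.exists_add_smul_mem hv
    have h1 := vsub_mem_vectorSpan ℝ hmem hx.1
    have h2 := Submodule.smul_mem _ ε⁻¹ h1
    simpa [smul_smul, inv_mul_cancel₀ hε.ne'] using h2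

end Polyhedron

end MAC

namespace MAC

open Finset

/-! ### Greedy points of a polymatroid. -/

section Greedy

variable {α β : Type*} [DecidableEq α] [LinearOrder β]

/-- The point with support `T` that is obtained from the set function `f` by increasing the
coordinates in the order given by `r`. -/
def greedy (f : Finset α → ℝ) (r : α → β) (T : Finset α) (i : α) : ℝ :=
  if i ∈ T then f {j ∈ T | r j ≤ r i} - f {j ∈ T | r j < r i} else 0

variable {f : Finset α → ℝ} {r : α → β} {T S : Finset α}

theorem greedy_of_notMem {i : α} (hi : i ∉ T) : greedy f r T i = 0 := if_neg hi

theorem filter_le_eq_insert (hr : r.Injective) {i : α} (hi : i ∈ T) :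
    {j ∈ T | r j ≤ r i} = insert i {j ∈ T | r j < r i} := by
  ext j
  simp only [mem_filter, mem_insert, le_iff_lt_or_eq, hr.eq_iff]
  constructor
  · tauto
  · rintro (rfl | h)
    · exact ⟨hi, Or.inr rfl⟩
    · tauto

/-- On an initial segment of the order the marginal gains telescope. Only `f ∅ = 0` is needed, which
later allows arbitrary prescribed values. -/
theorem sum_greedy_eq (hf : f ∅ = 0) (hr : r.Injective) (hST : S ⊆ T)
    (hS : ∀ i ∈ S, ∀ j ∈ T, r j ≤ r i → j ∈ S) : ∑ i ∈ S, greedy f r T i = f S := by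
  induction S using Finset.induction_on_max_value r with
  | empty => simp [hf]
  | insert a s ha hmax ih =>
    have haT : a ∈ T := hST (mem_insert_self a s)
    have hs : s = {j ∈ T | r j < r a} := by
      ext j
      simp only [mem_filter]
      constructor
      · intro hj
        exact ⟨hST (mem_insert_of_mem hj), lt_of_le_of_ne (hmax j hj)
          fun e => ha (hr e ▸ hj)⟩
      · rintro ⟨hjT, hj⟩
        refine (mem_insert.1 (hS a (mem_insert_self a s) j hjT hj.le)).resolve_left ?_
        rintro rfl
        exact lt_irrefl _ hj
    rw [sum_insert ha, ih ((subset_insert a s).trans hST), greedy, if_pos haT,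
      filter_le_eq_insert hr haT, ← hs, sub_add_cancel]
    intro i hi j hj hji
    rw [hs, mem_filter]
    have : r i < r a := lt_of_le_of_ne (hmax i hi) fun e => ha (hr e ▸ hi)
    exact ⟨hj, hji.trans_lt this⟩

theorem IsStrictPolymatroid.greedy_pos (hf : IsStrictPolymatroid f) (hr : r.Injective) {i : α}
    (hi : i ∈ T) : 0 < greedy f r T i := by
  rw [greedy, if_pos hi, filter_le_eq_insert hr hi, sub_pos]
  exact hf.strictMono (Finset.ssubset_insert (by simp))

theorem IsStrictPolymatroid.greedy_nonneg (hf : IsStrictPolymatroid f) (hr : r.Injective)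
    (i : α) : 0 ≤ greedy f r T i := by
  by_cases hi : i ∈ T
  · exact (hf.greedy_pos hr hi).le
  · rw [greedy_of_notMem hi]

/-- Strict submodularity leaves no tight subsets of `T` other than initial segments of the order. -/
theorem IsStrictPolymatroid.sum_greedy_of_subset (hf : IsStrictPolymatroid f)
    (hr : r.Injective) (hST : S ⊆ T) :
    ∑ i ∈ S, greedy f r T i ≤ f S ∧
      (∑ i ∈ S, greedy f r T i = f S → S = ∅ ∨ ∃ i ∈ T, S = {j ∈ T | r j ≤ r i}) := by
  induction S using Finset.induction_on_max_value r with
  | empty => simp [hf.map_empty]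
  | insert a s ha hmax ih =>
    have haT : a ∈ T := hST (mem_insert_self a s)
    have h1 := (ih ((subset_insert a s).trans hST)).1
    have hle := filter_le_eq_insert hr haT
    set L : Finset α := {j ∈ T | r j < r a} with hL
    have haL : a ∉ L := by simp [hL]
    rw [sum_insert ha, greedy, if_pos haT, hle, ← hL]
    by_cases hs : s = L
    · rw [← hs]
      refine ⟨by linarith, fun _ => Or.inr ⟨a, haT, ?_⟩⟩
      rw [hle, ← hs]
    · have hsL : s ⊆ L := by
        intro j hj
        exact mem_filter.2 ⟨hST (mem_insert_of_mem hj), lt_of_le_of_ne (hmax j hj)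
          fun e => ha (hr e ▸ hj)⟩
      -- The gain of `a` over the gappy set `s` strictly exceeds its gain over the full segment `L`,
      -- which is its greedy value.
      have h2 := hf.submodular (insert a s) L (fun h => haL (h (mem_insert_self a s))) (by
        intro h
        refine hs (hsL.antisymm fun j hj => (mem_insert.1 (h hj)).resolve_left ?_)
        rintro rfl
        exact haL hj)
      rw [insert_union, union_eq_right.2 hsL, insert_inter_of_notMem haL,
        inter_eq_left.2 hsL] at h2
      exact ⟨by linarith, fun h => by linarith⟩

theorem IsStrictPolymatroid.sum_greedy_le (hf : IsStrictPolymatroid f)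
    (hr : r.Injective) (S : Finset α) :
    ∑ i ∈ S, greedy f r T i ≤ f S ∧
      (∑ i ∈ S, greedy f r T i = f S → S = ∅ ∨ ∃ i ∈ T, S = {j ∈ T | r j ≤ r i}) := by
  by_cases hST : S ⊆ T
  · exact hf.sum_greedy_of_subset hr hST
  have h1 := (hf.sum_greedy_of_subset hr (inter_subset_right (s₁ := S) (s₂ := T))).1
  have h2 : ∑ i ∈ S ∩ T, greedy f r T i = ∑ i ∈ S, greedy f r T i := by
    refine sum_subset inter_subset_left fun i hi hi' => greedy_of_notMem fun h => hi' ?_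
    exact mem_inter.2 ⟨hi, h⟩
  have h3 : f (S ∩ T) < f S := hf.strictMono
    ⟨inter_subset_left, fun h => hST (h.trans inter_subset_right)⟩
  rw [h2] at h1
  exact ⟨by linarith, fun h => by linarith⟩

end Greedy

/-! ### Chains of sets and linear orders compatible with them. -/

section Flag

variable {α : Type*} [DecidableEq α]

/-- A chain of non-empty subsets of `T`. -/
structure IsFlag (T : Finset α) (𝒞 : Finset (Finset α)) : Prop where
  nonempty : ∀ S ∈ 𝒞, S.Nonempty
  subset : ∀ S ∈ 𝒞, S ⊆ T
  total : ∀ S ∈ 𝒞, ∀ S' ∈ 𝒞, S ⊆ S' ∨ S' ⊆ S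

/-- The number of members of `𝒞` that do not contain `i`. -/
def level (𝒞 : Finset (Finset α)) (i : α) : ℕ := #{S ∈ 𝒞 | i ∉ S}

variable {T : Finset α} {𝒞 : Finset (Finset α)}

theorem IsFlag.level_lt (h : IsFlag T 𝒞) {S : Finset α} (hS : S ∈ 𝒞) {i j : α} (hi : i ∈ S)
    (hj : j ∉ S) : level 𝒞 i < level 𝒞 j := by
  refine card_lt_card ⟨fun S' hS' => ?_, fun hsub => ?_⟩
  · rw [mem_filter] at hS' ⊢
    refine ⟨hS'.1, fun hj' => ?_⟩
    rcases h.total S hS S' hS'.1 with h1 | h1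
    · exact hS'.2 (h1 hi)
    · exact hj (h1 hj')
  · exact (mem_filter.1 (hsub (mem_filter.2 ⟨hS, hj⟩))).2 hi

/-- This set is the largest member of the chain that misses `e`. -/
theorem IsFlag.setOf_level_lt_mem (h : IsFlag T 𝒞) {e : α} (he : level 𝒞 e ≠ 0) :
    {j ∈ T | level 𝒞 j < level 𝒞 e} ∈ 𝒞 := by
  have hne : ({S ∈ 𝒞 | e ∉ S} : Finset _).Nonempty := by
    rwa [← Finset.card_pos, Nat.pos_iff_ne_zero]
  obtain ⟨U, hU, hmax⟩ := Finset.exists_max_image _ card hne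
  rw [mem_filter] at hU
  convert hU.1
  ext j
  rw [mem_filter]
  refine ⟨fun ⟨_, hj⟩ => ?_, fun hj => ⟨h.subset U hU.1 hj, h.level_lt hU.1 hj hU.2⟩⟩
  by_contra hjU
  refine hj.not_ge (card_le_card fun S hS => ?_)
  have hS' := mem_filter.1 hS
  refine mem_filter.2 ⟨hS'.1, fun hjS => ?_⟩
  rcases h.total S hS'.1 U hU.1 with h1 | h1
  · exact hjU (h1 hjS)
  · exact hjU (eq_of_subset_of_card_le h1 (hmax S hS) ▸ hjS)

/-- A linear order refining `level 𝒞`, in which `e` comes first among the elements of its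
level. -/
def flagRank (𝒞 : Finset (Finset α)) (e i : α) : ℕ ×ₗ (ℕ ×ₗ α) :=
  toLex (level 𝒞 i, toLex (if i = e then 0 else 1, i))

theorem flagRank_injective (e : α) : (flagRank 𝒞 e).Injective := by
  intro i j hij
  simp only [flagRank, EmbeddingLike.apply_eq_iff_eq, Prod.mk.injEq] at hij
  exact hij.2.2

variable [LinearOrder α]

theorem level_le_of_flagRank_le {e i j : α} (h : flagRank 𝒞 e i ≤ flagRank 𝒞 e j) :
    level 𝒞 i ≤ level 𝒞 j := by
  rw [flagRank, flagRank, Prod.Lex.toLex_le_toLex] at h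
  rcases h with h | h
  · exact h.le
  · exact h.1.le

theorem flagRank_self_le {e i : α} (h : level 𝒞 e ≤ level 𝒞 i) :
    flagRank 𝒞 e e ≤ flagRank 𝒞 e i := by
  rcases eq_or_ne i e with rfl | hne
  · exact le_rfl
  rw [flagRank, flagRank, Prod.Lex.toLex_le_toLex]
  rcases h.lt_or_eq with h | h
  · exact Or.inl h
  · refine Or.inr ⟨h, ?_⟩
    rw [Prod.Lex.toLex_le_toLex]
    simp [hne]

theorem IsFlag.mem_of_flagRank_le (h : IsFlag T 𝒞) {S : Finset α} (hS : S ∈ 𝒞) {e i j : α}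
    (hi : i ∈ S) (hji : flagRank 𝒞 e j ≤ flagRank 𝒞 e i) : j ∈ S := by
  by_contra hj
  exact (h.level_lt hS hi hj).not_ge (level_le_of_flagRank_le hji)

theorem IsFlag.sum_greedy (h : IsFlag T 𝒞) {f : Finset α → ℝ} (hf : f ∅ = 0) (e : α)
    {S : Finset α} (hS : S ∈ 𝒞) : ∑ i ∈ S, greedy f (flagRank 𝒞 e) T i = f S :=
  sum_greedy_eq hf (flagRank_injective e) (h.subset S hS)
    fun _ hi _ _ hji => h.mem_of_flagRank_le hS hi hji

/-- A set tight for every choice of `e` is an initial segment of all the orders `flagRank 𝒞 e`.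
Taking `e` of least level in `T \ S` and placing it first in its level forces `S` to be the set of
lower levels, a member of the chain. The set `T` is excluded since it is an initial segment of every
order. -/
theorem IsFlag.exists_sum_greedy_lt (h : IsFlag T 𝒞) {f : Finset α → ℝ}
    (hf : IsStrictPolymatroid f) {S : Finset α} (hS0 : S.Nonempty) (hS : S ∉ 𝒞) (hST : S ≠ T) :
    ∃ e, ∑ i ∈ S, greedy f (flagRank 𝒞 e) T i < f S := by
  by_contra! hcon
  have hinit : ∀ e, ∃ i ∈ T, S = {j ∈ T | flagRank 𝒞 e j ≤ flagRank 𝒞 e i} := fun e => by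
    have h1 := hf.sum_greedy_le (T := T) (flagRank_injective (𝒞 := 𝒞) e) S
    exact (h1.2 (le_antisymm h1.1 (hcon e))).resolve_left hS0.ne_empty
  have hlow : ∀ e, ∀ i ∈ S, ∀ j ∈ T, flagRank 𝒞 e j ≤ flagRank 𝒞 e i → j ∈ S := by
    intro e i hi j hj hji
    obtain ⟨m, -, hm⟩ := hinit e
    rw [hm] at hi ⊢
    exact mem_filter.2 ⟨hj, hji.trans (mem_filter.1 hi).2⟩
  obtain ⟨i₀, hi₀⟩ := hS0
  have hsub : S ⊆ T := by
    obtain ⟨m, -, hm⟩ := hinit i₀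
    rw [hm]
    exact filter_subset _ _
  obtain ⟨e, he, hmin⟩ := Finset.exists_min_image (T \ S) (level 𝒞)
    (Finset.sdiff_nonempty.2 fun h' => hST (hsub.antisymm h'))
  rw [mem_sdiff] at he
  have hlt : ∀ i ∈ S, level 𝒞 i < level 𝒞 e := by
    intro i hi
    by_contra! hle
    exact he.2 (hlow e i hi e he.1 (flagRank_self_le hle))
  apply hS
  have hmem := h.setOf_level_lt_mem (e := e) (Nat.ne_zero_of_lt (hlt i₀ hi₀))
  convert hmem
  ext j
  rw [mem_filter]
  refine ⟨fun hj => ⟨hsub hj, hlt j hj⟩, fun ⟨hjT, hj⟩ => ?_⟩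
  by_contra hjS
  exact (hmin j (mem_sdiff.2 ⟨hjT, hjS⟩)).not_gt hj

end Flag

/-! ### Faces of a strict polymatroid as pairs of a support and a chain. -/

section PolymatroidFaces

variable {M : ℕ}

/-- The normal vectors of the inequalities `0 ≤ R i` and `R(S) ≤ f S`. -/
def rateNormal : Fin M ⊕ Finset (Fin M) → Fin M → ℝ
  | .inl i => -Pi.single i 1
  | .inr S => fun j => if j ∈ S then 1 else 0

/-- The right-hand sides of the inequalities `0 ≤ R i` and `R(S) ≤ f S`. -/
def rateBound (f : Finset (Fin M) → ℝ) : Fin M ⊕ Finset (Fin M) → ℝ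
  | .inl _ => 0
  | .inr S => f S

@[simp]
theorem dotProduct_rateNormal_inl (x : Fin M → ℝ) (i : Fin M) :
    x ⬝ᵥ rateNormal (.inl i) = -x i := by
  simp [rateNormal]

@[simp]
theorem dotProduct_rateNormal_inr (x : Fin M → ℝ) (S : Finset (Fin M)) :
    x ⬝ᵥ rateNormal (.inr S) = ∑ i ∈ S, x i := by
  simp [rateNormal, dotProduct]

theorem mem_polyhedron_rate {f : Finset (Fin M) → ℝ} {x : Fin M → ℝ} :
    x ∈ polyhedron rateNormal (rateBound f) ↔
      (∀ i, 0 ≤ x i) ∧ ∀ S : Finset (Fin M), ∑ i ∈ S, x i ≤ f S := by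
  simp [polyhedron, rateBound]

/-- The inequalities that are tight on the face with support `T` and tight sets `𝒞`. -/
def flagTight (T : Finset (Fin M)) (𝒞 : Finset (Finset (Fin M))) : Set (Fin M ⊕ Finset (Fin M)) :=
  {k | Sum.elim (fun i => i ∉ T) (fun S => S = ∅ ∨ S ∈ 𝒞) k}

variable {f : Finset (Fin M) → ℝ} {T : Finset (Fin M)} {𝒞 : Finset (Finset (Fin M))}

@[simp]
theorem inl_mem_flagTight {i : Fin M} : .inl i ∈ flagTight T 𝒞 ↔ i ∉ T := Iff.rfl

@[simp]
theorem inr_mem_flagTight {S : Finset (Fin M)} : .inr S ∈ flagTight T 𝒞 ↔ S = ∅ ∨ S ∈ 𝒞 :=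
  Iff.rfl

/-- A support `U` smaller than `T` is allowed because the greedy points of `T` itself never make the
inequality of `T` slack. -/
theorem IsFlag.greedy_mem_tightFace {U : Finset (Fin M)} (hU' : IsFlag U 𝒞) (hU : U ⊆ T)
    (hf : IsStrictPolymatroid f) (e : Fin M) :
    greedy f (flagRank 𝒞 e) U ∈ tightFace rateNormal (rateBound f) (flagTight T 𝒞) := by
  refine ⟨mem_polyhedron_rate.2 ⟨hf.greedy_nonneg (flagRank_injective e),
    fun S => (hf.sum_greedy_le (flagRank_injective e) S).1⟩, ?_⟩
  rintro (i | S) hk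
  · simp only [dotProduct_rateNormal_inl, rateBound, neg_eq_zero]
    exact greedy_of_notMem fun hi => hk (hU hi)
  · rw [dotProduct_rateNormal_inr]
    rcases hk with rfl | hS
    · simp [rateBound, hf.map_empty]
    · exact hU'.sum_greedy hf.map_empty e hS

theorem IsFlag.exists_isStrictPoint (h : IsFlag T 𝒞) (hf : IsStrictPolymatroid f) :
    ∃ x, IsStrictPoint rateNormal (rateBound f) (flagTight T 𝒞) x := by
  rcases isEmpty_or_nonempty (Fin M) with hM | ⟨⟨e₀⟩⟩
  · refine ⟨0, ⟨mem_polyhedron_rate.2 ⟨by simp, fun S => ?_⟩, ?_⟩, ?_⟩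
    · rw [Subsingleton.elim S ∅, hf.map_empty]
      simp
    · rintro (i | S) hk
      · exact hM.elim i
      · simp [Subsingleton.elim S ∅, rateBound, hf.map_empty]
    · rintro (i | S) hk
      · exact hM.elim i
      · simp [Subsingleton.elim S ∅] at hk
  have hmem := fun e => h.greedy_mem_tightFace subset_rfl hf e
  refine exists_forall_dotProduct_lt convex_tightFace (fun x hx => hx.1) ⟨_, hmem e₀⟩ ?_
  rintro (i | S) hk
  · rw [inl_mem_flagTight, not_not] at hk
    refine ⟨_, hmem e₀, ?_⟩
    rw [dotProduct_rateNormal_inl]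
    exact neg_neg_of_pos (hf.greedy_pos (flagRank_injective e₀) hk)
  · rw [inr_mem_flagTight, not_or] at hk
    simp only [dotProduct_rateNormal_inr, rateBound]
    rcases eq_or_ne S T with rfl | hST
    · have hU : 𝒞.sup id ⊆ S := Finset.sup_le h.subset
      have hU' : IsFlag (𝒞.sup id) 𝒞 :=
        ⟨h.nonempty, fun S' hS' => Finset.le_sup (f := id) hS', h.total⟩
      refine ⟨_, hU'.greedy_mem_tightFace hU hf e₀, ?_⟩
      have h1 := hf.sum_greedy_le (T := 𝒞.sup id) (flagRank_injective (𝒞 := 𝒞) e₀) S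
      refine lt_of_le_of_ne h1.1 fun heq => ?_
      obtain ⟨i, hi, hS⟩ := (h1.2 heq).resolve_left hk.1
      obtain ⟨S', hS', hiS'⟩ := Finset.mem_sup.1 hi
      refine hk.2 ?_
      convert hS'
      refine subset_antisymm (fun j hj => ?_) (h.subset S' hS')
      rw [hS] at hj
      exact h.mem_of_flagRank_le hS' hiS' (mem_filter.1 hj).2
    · obtain ⟨e, he⟩ := h.exists_sum_greedy_lt hf (nonempty_iff_ne_empty.2 hk.1) hk.2 hST
      exact ⟨_, hmem e, he⟩

theorem IsStrictPoint.exists_isFlag (hf : IsStrictPolymatroid f)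
    {J : Set (Fin M ⊕ Finset (Fin M))} {x : Fin M → ℝ}
    (hx : IsStrictPoint rateNormal (rateBound f) J x) :
    ∃ T 𝒞, IsFlag T 𝒞 ∧ J = flagTight T 𝒞 := by
  classical
  obtain ⟨hpos, hle⟩ := mem_polyhedron_rate.1 hx.1.1
  have hinl : ∀ i, .inl i ∈ J → x i = 0 := fun i hi => by simpa [rateBound] using hx.1.2 _ hi
  have hinl' : ∀ i, .inl i ∉ J → 0 < x i := fun i hi => by simpa [rateBound] using hx.2 _ hi
  have hinr : ∀ S, .inr S ∈ J → ∑ i ∈ S, x i = f S := fun S hS => by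
    simpa [rateBound] using hx.1.2 _ hS
  have hinr' : ∀ S, .inr S ∉ J → ∑ i ∈ S, x i < f S := fun S hS => by
    simpa [rateBound] using hx.2 _ hS
  refine ⟨({i | .inl i ∉ J} : Finset (Fin M)), ({S | S.Nonempty ∧ .inr S ∈ J} : Finset _),
    ⟨?_, ?_, ?_⟩, ?_⟩
  · simp +contextual
  · intro S hS i hi
    simp only [mem_filter, mem_univ, true_and] at hS ⊢
    intro hiJ
    have h1 := hinr S hS.2
    rw [← Finset.add_sum_erase S x hi, hinl i hiJ, zero_add] at h1
    have h2 := hle (S.erase i)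
    have h3 := hf.strictMono (Finset.erase_ssubset hi)
    -- A tight set contains no zero coordinate: erasing it keeps the sum but strictly lowers the
    -- bound.
    linarith
  · intro S hS S' hS'
    simp only [mem_filter, mem_univ, true_and] at hS hS'
    by_contra! hcon
    have h1 := hf.submodular S S' hcon.1 hcon.2
    have h2 := Finset.sum_union_inter (s₁ := S) (s₂ := S') (f := x)
    have h3 := hle (S ∪ S')
    have h4 := hle (S ∩ S')
    rw [hinr S hS.2, hinr S' hS'.2] at h2
    linarith
  · ext (i | S)
    · simp
    · rcases S.eq_empty_or_nonempty with rfl | hS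
      · simp only [inr_mem_flagTight, true_or, iff_true]
        by_contra hmem
        have := hinr' ∅ hmem
        simp [hf.map_empty] at this
      · simp [hS, hS.ne_empty]

/-- The tight equations are independent: the map `L` of coordinates off `T` and sums over chain
members is onto, with greedy points of arbitrary set functions as preimages. Rank-nullity then gives
the dimension. -/
theorem IsFlag.finrank_tightSubmodule (h : IsFlag T 𝒞) :
    Module.finrank ℝ (tightSubmodule rateNormal (flagTight T 𝒞)) + #𝒞 = #T := by
  let L : (Fin M → ℝ) →ₗ[ℝ] ({i // i ∈ Tᶜ} → ℝ) × ({S // S ∈ 𝒞} → ℝ) :=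
    (LinearMap.pi fun i => LinearMap.proj i.1).prod
      (LinearMap.pi fun S => ∑ i ∈ S.1, LinearMap.proj i)
  have hker : tightSubmodule rateNormal (flagTight T 𝒞) = LinearMap.ker L := by
    ext v
    simp only [LinearMap.mem_ker, L, LinearMap.prod_apply, Function.prod_apply, Prod.mk_eq_zero,
      funext_iff, LinearMap.pi_apply, LinearMap.proj_apply, LinearMap.sum_apply, Pi.zero_apply,
      Subtype.forall, mem_compl]
    constructor
    · intro hv
      exact ⟨fun i hi => by simpa using hv (.inl i) hi,
        fun S hS => by simpa using hv (.inr S) (Or.inr hS)⟩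
    · rintro ⟨h1, h2⟩ (i | S) hk
      · simpa using h1 i hk
      · rw [dotProduct_rateNormal_inr]
        rcases hk with rfl | hS
        · simp
        · exact h2 S hS
  have hsurj : LinearMap.range L = ⊤ := by
    rw [LinearMap.range_eq_top]
    rintro ⟨y, w⟩
    let g : Finset (Fin M) → ℝ := fun S => if hS : S ∈ 𝒞 then w ⟨S, hS⟩ else 0
    have hg : g ∅ = 0 := dif_neg fun h0 => Finset.not_nonempty_empty (h.nonempty ∅ h0)
    by_cases hM : Nonempty (Fin M)
    · obtain ⟨e⟩ := hM
      refine ⟨fun i => if hi : i ∈ Tᶜ then y ⟨i, hi⟩ else greedy g (flagRank 𝒞 e) T i, ?_⟩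
      refine Prod.ext (funext fun i => ?_) (funext fun S => ?_)
      · simp [L, mem_compl.1 i.2]
      · simp only [L, LinearMap.prod_apply, Function.prod_apply, LinearMap.pi_apply,
          LinearMap.sum_apply, LinearMap.proj_apply]
        have h1 := h.sum_greedy hg e S.2
        rw [show g S = w S from dif_pos S.2] at h1
        rw [← h1]
        refine Finset.sum_congr rfl fun i hi => dif_neg ?_
        simpa using h.subset S.1 S.2 hi
    · refine ⟨0, Prod.ext (funext fun i => (hM ⟨i.1⟩).elim) (funext fun S => ?_)⟩
      exact (hM ⟨(h.nonempty S.1 S.2).choose⟩).elim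
  have h1 := LinearMap.finrank_range_add_finrank_ker L
  rw [hsurj, finrank_top, ← hker] at h1
  simp only [Module.finrank_prod, Module.finrank_fintype_fun_eq_card, Fintype.card_coe,
    Fintype.card_fin, card_compl] at h1
  have h2 : #T ≤ M := by simpa using card_le_univ T
  omega

theorem flagTight_injOn : Set.InjOn
    (fun p : Finset (Fin M) × Finset (Finset (Fin M)) => flagTight p.1 p.2)
    {p | IsFlag p.1 p.2} := by
  rintro ⟨T, 𝒞⟩ h ⟨T', 𝒞'⟩ h' heq
  simp only [Set.ext_iff] at heq
  refine Prod.ext (Finset.ext fun i => ?_) (Finset.ext fun S => ?_)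
  · simpa [not_iff_not] using heq (.inl i)
  · rcases S.eq_empty_or_nonempty with rfl | hS
    · exact iff_of_false (fun h0 => not_nonempty_empty (h.nonempty ∅ h0))
        fun h0 => not_nonempty_empty (h'.nonempty ∅ h0)
    · simpa [hS.ne_empty] using heq (.inr S)

open Classical in
/-- The faces of dimension `D` correspond to the flags with `D` fewer members than the
underlying set has elements. -/
theorem IsStrictPolymatroid.facesOfDim_eq_image (hf : IsStrictPolymatroid f) (D : ℕ) :
    facesOfDim (polyhedron rateNormal (rateBound f)) D =
      (fun p : Finset (Fin M) × Finset (Finset (Fin M)) =>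
        tightFace rateNormal (rateBound f) (flagTight p.1 p.2)) ''
      ↑({p | IsFlag p.1 p.2 ∧ #p.2 + D = #p.1} :
        Finset (Finset (Fin M) × Finset (Finset (Fin M)))) := by
  ext F
  simp only [facesOfDim, Set.mem_ofPred_eq, Set.mem_image, coe_filter, mem_univ, true_and]
  constructor
  · rintro ⟨hF, hdim⟩
    have hne : F.Nonempty := by
      rw [Set.nonempty_iff_ne_empty]
      rintro rfl
      rw [affDim, if_pos rfl] at hdim
      omega
    obtain ⟨J, x, hx, rfl⟩ := hF.exists_eq_tightFace hne
    obtain ⟨T, 𝒞, hflag, rfl⟩ := hx.exists_isFlag hf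
    refine ⟨(T, 𝒞), ⟨hflag, ?_⟩, rfl⟩
    rw [hx.affDim_tightFace] at hdim
    have := hflag.finrank_tightSubmodule
    change #𝒞 + D = #T
    omega
  · rintro ⟨⟨T, 𝒞⟩, ⟨hflag, hcard⟩, rfl⟩
    dsimp only at hflag hcard ⊢
    obtain ⟨x, hx⟩ := hflag.exists_isStrictPoint hf
    refine ⟨isFace_tightFace, ?_⟩
    rw [hx.affDim_tightFace]
    have := hflag.finrank_tightSubmodule
    omega

theorem IsStrictPolymatroid.tightFace_injOn (hf : IsStrictPolymatroid f) : Set.InjOn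
    (fun p : Finset (Fin M) × Finset (Finset (Fin M)) =>
      tightFace rateNormal (rateBound f) (flagTight p.1 p.2)) {p | IsFlag p.1 p.2} := by
  intro p hp q hq heq
  obtain ⟨x, hx⟩ := IsFlag.exists_isStrictPoint hp hf
  obtain ⟨y, hy⟩ := IsFlag.exists_isStrictPoint hq hf
  refine flagTight_injOn hp hq ?_
  simp only at heq ⊢
  rw [hx.eq_setOf, hy.eq_setOf, heq]

end PolymatroidFaces

end MAC

namespace MAC

open Finset

/-! ### Counting chains by inclusion-exclusion. -/

section FlagCount

variable {α : Type*} [DecidableEq α] [Fintype α]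

/-- The points of `T` at which a function to `Fin (k + 1)` is at most `l`. -/
def sublevel {k : ℕ} (T : Finset α) (h : T → Fin (k + 1)) (l : Fin k) : Finset α :=
  {i | ∃ hi : i ∈ T, h ⟨i, hi⟩ ≤ l.castSucc}

theorem mem_sublevel {k : ℕ} {T : Finset α} {h : T → Fin (k + 1)} {l : Fin k} {i : α} :
    i ∈ sublevel T h l ↔ ∃ hi : i ∈ T, h ⟨i, hi⟩ ≤ l.castSucc := by
  simp [sublevel]

theorem sublevel_mono {k : ℕ} {T : Finset α} {h : T → Fin (k + 1)} : Monotone (sublevel T h) := by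
  intro l l' hl i hi
  obtain ⟨hiT, hi⟩ := mem_sublevel.1 hi
  exact mem_sublevel.2 ⟨hiT, hi.trans (Fin.castSucc_le_castSucc_iff.2 hl)⟩

/-- The sublevel sets in `T` of a function to `Fin (k + 1)`, except the one of the top value. -/
def sublevelFlag {k : ℕ} (T : Finset α) (h : T → Fin (k + 1)) : Finset (Finset α) :=
  univ.image (sublevel T h)

theorem sublevel_injective {k : ℕ} {T : Finset α} {h : T → Fin (k + 1)}
    (hh : ∀ l : Fin k, ∃ x, h x = l.castSucc) :
    (sublevel T h).Injective := by
  refine StrictMono.injective fun l l' hl =>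
    Finset.ssubset_iff_subset_ne.2 ⟨sublevel_mono hl.le, fun heq => ?_⟩
  obtain ⟨x, hx⟩ := hh l'
  have h1 : x.1 ∈ sublevel T h l := heq ▸ mem_sublevel.2 ⟨x.2, hx.le⟩
  obtain ⟨_, h2⟩ := mem_sublevel.1 h1
  rw [Subtype.coe_eta, hx, Fin.castSucc_le_castSucc_iff] at h2
  exact h2.not_gt hl

theorem card_sublevelFlag {k : ℕ} {T : Finset α} {h : T → Fin (k + 1)}
    (hh : ∀ l : Fin k, ∃ x, h x = l.castSucc) : #(sublevelFlag T h) = k := by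
  rw [sublevelFlag, card_image_of_injective _ (sublevel_injective hh), card_univ, Fintype.card_fin]

theorem isFlag_sublevelFlag {k : ℕ} {T : Finset α} {h : T → Fin (k + 1)}
    (hh : ∀ l : Fin k, ∃ x, h x = l.castSucc) : IsFlag T (sublevelFlag T h) := by
  refine ⟨?_, ?_, ?_⟩
  · simp only [sublevelFlag, mem_image, mem_univ, true_and, forall_exists_index,
      forall_apply_eq_imp_iff]
    intro l
    obtain ⟨x, hx⟩ := hh l
    exact ⟨x.1, mem_sublevel.2 ⟨x.2, hx.le⟩⟩
  · simp only [sublevelFlag, mem_image, mem_univ, true_and, forall_exists_index,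
      forall_apply_eq_imp_iff]
    intro l i hi
    exact (mem_sublevel.1 hi).1
  · simp only [sublevelFlag, mem_image, mem_univ, true_and, forall_exists_index,
      forall_apply_eq_imp_iff]
    intro l l'
    exact (le_total l l').imp (fun h => sublevel_mono h) (fun h => sublevel_mono h)

theorem level_sublevelFlag {k : ℕ} {T : Finset α} {h : T → Fin (k + 1)}
    (hh : ∀ l : Fin k, ∃ x, h x = l.castSucc) (x : T) :
    level (sublevelFlag T h) x = h x := by
  rw [level, sublevelFlag, filter_image, card_image_of_injective _ (sublevel_injective hh)]
  have h1 : univ.filter (fun l : Fin k => x.1 ∉ sublevel T h l) =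
      univ.filter fun l : Fin k => (l : ℕ) < h x := by
    ext l
    simp only [mem_filter, mem_univ, true_and, mem_sublevel, Subtype.coe_eta, x.2, exists_true_left, not_le,
      Fin.lt_def, Fin.val_castSucc]
  rw [h1, Fin.card_filter_val_lt]
  have := (h x).2
  omega

/-- The map is `level 𝒞`. Its top value is missed exactly when `T` is empty or belongs to the chain.
-/
theorem IsFlag.exists_sublevelFlag_eq {T : Finset α} {𝒞 : Finset (Finset α)} (hC : IsFlag T 𝒞) :
    ∃ h : T → Fin (#𝒞 + 1), (∀ l : Fin #𝒞, ∃ x, h x = l.castSucc) ∧ sublevelFlag T h = 𝒞 := by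
  refine ⟨fun x => ⟨level 𝒞 x, Nat.lt_succ_of_le (card_filter_le _ _)⟩, ?_⟩
  set h : T → Fin (#𝒞 + 1) := fun x => ⟨level 𝒞 x, Nat.lt_succ_of_le (card_filter_le _ _)⟩ with hh
  have hsub : 𝒞 ⊆ sublevelFlag T h := by
    intro S hS
    have hlt : #{S' ∈ 𝒞 | S' ⊂ S} < #𝒞 :=
      card_lt_card ⟨filter_subset _ _, fun h' => (mem_filter.1 (h' hS)).2.ne rfl⟩
    -- A member of the chain is the sublevel set at the number of members strictly inside it.
    refine mem_image.2 ⟨⟨_, hlt⟩, mem_univ _, ?_⟩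
    ext i
    simp only [mem_sublevel, hh, Fin.le_def, Fin.val_castSucc]
    constructor
    · rintro ⟨-, hi⟩
      by_contra hiS
      refine hi.not_gt (card_lt_card ⟨fun S' hS' => ?_, fun h' => ?_⟩)
      · rw [mem_filter] at hS' ⊢
        exact ⟨hS'.1, fun h' => hiS (hS'.2.1 h')⟩
      · exact (mem_filter.1 (h' (mem_filter.2 ⟨hS, hiS⟩))).2.ne rfl
    · intro hi
      refine ⟨hC.subset S hS hi, card_le_card fun S' hS' => ?_⟩
      rw [mem_filter] at hS' ⊢
      refine ⟨hS'.1, ?_⟩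
      rcases hC.total S' hS'.1 S hS with h1 | h1
      · exact ⟨h1, fun h2 => hS'.2 (h2 hi)⟩
      · exact absurd (h1 hi) hS'.2
  have hle : #(sublevelFlag T h) ≤ #𝒞 := by
    refine card_image_le.trans ?_
    rw [card_univ, Fintype.card_fin]
  have heq : 𝒞 = sublevelFlag T h := eq_of_subset_of_card_le hsub hle
  have hinj : (sublevel T h).Injective := by
    rw [← Set.injOn_univ, ← coe_univ, ← card_image_iff, card_univ, Fintype.card_fin]
    exact congrArg card heq.symm
  refine ⟨fun l => ?_, heq.symm⟩
  by_contra! hcon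
  -- A missed value 0 would give an empty member; a missed value `l > 0` would make the sublevel
  -- sets at `l - 1` and `l` equal.
  rcases Nat.eq_zero_or_pos l with h0 | h0
  · have hmem : sublevel T h l ∈ 𝒞 :=
      heq.symm.subset (mem_image_of_mem _ (mem_univ l))
    obtain ⟨i, hi⟩ := hC.nonempty _ hmem
    obtain ⟨hiT, hi⟩ := mem_sublevel.1 hi
    refine hcon ⟨i, hiT⟩ (Fin.ext ?_)
    rw [Fin.le_def] at hi
    simp only [Fin.val_castSucc] at hi ⊢
    omega
  · have hl : (l : ℕ) - 1 < #𝒞 := by omega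
    have h1 : l = ⟨(l : ℕ) - 1, hl⟩ := by
      apply hinj
      ext i
      simp only [mem_sublevel]
      refine exists_congr fun hiT => ?_
      have := hcon ⟨i, hiT⟩
      rw [Ne, Fin.ext_iff] at this
      simp only [Fin.le_def, Fin.val_castSucc] at this ⊢
      omega
    have := congrArg Fin.val h1
    simp only at this
    omega

open Classical in
theorem card_isFlag_eq (T : Finset α) (k : ℕ) :
    #{𝒞 : Finset (Finset α) | IsFlag T 𝒞 ∧ #𝒞 = k} =
      #{h : T → Fin (k + 1) | ∀ l : Fin k, ∃ x, h x = l.castSucc} := by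
  symm
  refine card_nbij (sublevelFlag T) ?_ ?_ ?_
  · intro h hh
    simp only [coe_filter, mem_univ, true_and, Set.mem_ofPred_eq] at hh ⊢
    exact ⟨isFlag_sublevelFlag hh, card_sublevelFlag hh⟩
  · intro h hh h' hh' heq
    simp only [coe_filter, mem_univ, true_and, Set.mem_ofPred_eq] at hh hh'
    funext x
    apply Fin.ext
    rw [← level_sublevelFlag hh, ← level_sublevelFlag hh', heq]
  · intro 𝒞 h𝒞
    simp only [coe_filter, mem_univ, true_and, Set.mem_ofPred_eq] at h𝒞
    obtain ⟨hflag, rfl⟩ := h𝒞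
    obtain ⟨h, hh, heq⟩ := hflag.exists_sublevelFlag_eq
    exact ⟨h, by simpa using hh, heq⟩

theorem card_forall_exists_eq {β : Type*} [DecidableEq β] [Fintype β] (k : ℕ) :
    (#{h : β → Fin (k + 1) | ∀ l : Fin k, ∃ x, h x = l.castSucc} : ℤ) =
      ∑ t ∈ range (k + 1), (-1) ^ t * (k.choose t : ℤ) * ((k : ℤ) + 1 - t) ^ Fintype.card β := by
  -- `A l` collects the maps that miss the value `l`; the top value is unconstrained.
  let A : Fin k → Finset (β → Fin (k + 1)) := fun l => {h | ∀ x, h x ≠ l.castSucc}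
  have h1 : ({h : β → Fin (k + 1) | ∀ l : Fin k, ∃ x, h x = l.castSucc} : Finset _) =
      univ.inf fun l => (A l)ᶜ := by
    ext h
    simp [A, Finset.mem_inf]
  have h2 : ∀ t : Finset (Fin k), (#(t.inf A) : ℤ) = ((k : ℤ) + 1 - #t) ^ Fintype.card β := by
    intro t
    have h3 : t.inf A = Fintype.piFinset fun _ : β => (t.map Fin.castSuccEmb)ᶜ := by
      ext h
      simp only [Finset.mem_inf, A, mem_filter, mem_univ, true_and, Fintype.mem_piFinset,
        mem_compl, mem_map, not_exists, not_and, Fin.coe_castSuccEmb]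
      exact ⟨fun H x l hl e => H l hl x e.symm, fun H l hl x e => H x l hl e.symm⟩
    have h4 : #t ≤ k := by simpa using card_le_univ t
    rw [h3, Fintype.card_piFinset, prod_const, card_univ, card_compl, card_map, Fintype.card_fin,
      Nat.cast_pow, Nat.cast_sub (by omega)]
    push_cast
    ring
  rw [h1, inclusion_exclusion_card_inf_compl]
  simp_rw [h2]
  rw [Finset.sum_powerset_apply_card (fun t => (-1 : ℤ) ^ t * ((k : ℤ) + 1 - t) ^ Fintype.card β),
    card_univ, Fintype.card_fin]
  refine sum_congr rfl fun t _ => ?_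
  rw [nsmul_eq_mul]
  ring

theorem sum_range_choose_eq (i k : ℕ) :
    ∑ t ∈ range (k + 1), (-1) ^ t * (k.choose t : ℤ) * ((k : ℤ) + 1 - t) ^ i =
      ((k : ℤ) + 1) ^ i -
        ∑ j ∈ Icc 1 k, (k.choose (j - 1) : ℤ) * (-1) ^ (k - j) * (j : ℤ) ^ i := by
  rw [sum_range_succ', sub_eq_neg_add (((k : ℤ) + 1) ^ i), ← sum_neg_distrib]
  congr 1
  · refine sum_bij' (fun t _ => k - t) (fun j _ => k - j) ?_ ?_ ?_ ?_ ?_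
    · simp only [mem_range, mem_Icc]; omega
    · simp only [mem_range, mem_Icc]; omega
    · simp only [mem_range]; omega
    · simp only [mem_Icc]; omega
    · intro t ht
      rw [mem_range] at ht
      have h1 : k.choose (t + 1) = k.choose (k - t - 1) := by
        rw [← Nat.choose_symm (by omega : t + 1 ≤ k)]
        rfl
      have h2 : k - (k - t) = t := by omega
      rw [h1, h2, Nat.cast_sub ht.le]
      push_cast
      ring
  · simp

open Classical in
theorem card_flags (n D : ℕ) :
    (#{p : Finset (Fin n) × Finset (Finset (Fin n)) | IsFlag p.1 p.2 ∧ #p.2 + D = #p.1} : ℤ) =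
      ∑ i ∈ Icc D n, (n.choose i : ℤ) *
        (((i : ℤ) + 1 - (D : ℤ)) ^ i -
          ∑ j ∈ Icc 1 (i - D),
            ((i - D).choose (j - 1) : ℤ) * (-1) ^ (i - D - j) * (j : ℤ) ^ i) := by
  have h1 : #{p : Finset (Fin n) × Finset (Finset (Fin n)) | IsFlag p.1 p.2 ∧ #p.2 + D = #p.1} =
      ∑ T : Finset (Fin n), #{𝒞 : Finset (Finset (Fin n)) | IsFlag T 𝒞 ∧ #𝒞 + D = #T} := by
    simp only [card_filter, Fintype.sum_prod_type]
  -- The value 0 for `i < D` reflects that no chain has the negative size `i − D`.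
  let G : ℕ → ℤ := fun i => if D ≤ i then
    (((i : ℤ) + 1 - (D : ℤ)) ^ i - ∑ j ∈ Icc 1 (i - D),
      ((i - D).choose (j - 1) : ℤ) * (-1) ^ (i - D - j) * (j : ℤ) ^ i) else 0
  have h2 : ∀ T : Finset (Fin n),
      (#{𝒞 : Finset (Finset (Fin n)) | IsFlag T 𝒞 ∧ #𝒞 + D = #T} : ℤ) = G #T := by
    intro T
    by_cases hD : D ≤ #T
    · have h3 : ∀ 𝒞 : Finset (Finset (Fin n)), #𝒞 + D = #T ↔ #𝒞 = #T - D := by omega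
      simp_rw [h3, card_isFlag_eq, card_forall_exists_eq, sum_range_choose_eq]
      simp only [G, if_pos hD, Fintype.card_coe, Nat.cast_sub hD]
      ring_nf
    · simp only [G, if_neg hD, Nat.cast_eq_zero, card_eq_zero, filter_eq_empty_iff]
      rintro 𝒞 - ⟨-, h⟩
      omega
  rw [h1, Nat.cast_sum]
  simp_rw [h2]
  rw [← powerset_univ, sum_powerset_apply_card G, card_univ, Fintype.card_fin]
  have h4 : Icc D n = {i ∈ range (n + 1) | D ≤ i} := by
    ext i
    simp only [mem_Icc, mem_filter, mem_range]
    omega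
  rw [h4, sum_filter]
  refine sum_congr rfl fun i _ => ?_
  rw [nsmul_eq_mul]
  simp only [G, mul_ite, mul_zero]

end FlagCount

end MAC

theorem mainTheorem7 {M : ℕ} {𝒳 : Fin M → Type*} [∀ i, Fintype (𝒳 i)] {𝒴 : Type*} [Fintype 𝒴]
    (W : (∀ i, 𝒳 i) → 𝒴 → ℝ) (hW : ∀ x, W x ∈ stdSimplex ℝ 𝒴)
    (P : ∀ i, 𝒳 i → ℝ) (hP : ∀ i, P i ∈ stdSimplex ℝ (𝒳 i))
    (hR : MAC.NonDegenerated W P) (D : ℕ) (hD : D ≤ M) :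
    (MAC.facesOfDim (MAC.rateRegion W P) D).Finite ∧
      ((MAC.facesOfDim (MAC.rateRegion W P) D).ncard : ℤ) =
        ∑ i ∈ Finset.Icc D M, (M.choose i : ℤ) *
          (((i : ℤ) + 1 - (D : ℤ)) ^ i -
            ∑ j ∈ Finset.Icc 1 (i - D),
              ((i - D).choose (j - 1) : ℤ) * (-1) ^ (i - D - j) * (j : ℤ) ^ i) := by
  have hf := hR.isStrictPolymatroid hW hP
  have hreg : MAC.rateRegion W P =
      MAC.polyhedron MAC.rateNormal (MAC.rateBound fun S => MAC.info W P S Sᶜ) := by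
    ext x
    rw [MAC.mem_polyhedron_rate]
    rfl
  rw [hreg, hf.facesOfDim_eq_image D]
  refine ⟨(Finset.finite_toSet _).image _, ?_⟩
  rw [Set.InjOn.ncard_image, Set.ncard_coe_finset, MAC.card_flags]
  refine hf.tightFace_injOn.mono fun p hp => ?_
  simp only [Finset.coe_filter, Set.mem_ofPred_eq] at hp
  exact hp.2.1
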